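/- Let $\mathcal S$ be a block algebra, i.e. a $C^*$-algebra isomorphic to $\mathrm{Mat}_s(\mathbb C)$ for some integer $s>0$. Let $\mathcal H$ be the Hilbert space with orthonormal basis $\{v(i_1\cdots i_k)\}$ indexed by all finite sequences of positive integers, including the empty one (Boltzmann–Fock space). Write $\phi(A)=(v(\emptyset),A\,v(\emptyset))$ for $A\in B(\mathcal H)$ (inner product linear on the right), and let $\phi_{\mathcal S}:B(\mathcal H)\otimes\mathcal S\to\mathcal S$ be the linear map with $\phi_{\mathcal S}(x\otimes y)=\phi(x)y$. For $\ell\ge 1$ let $\Sigma_\ell\in B(\mathcal H)$ be the isometry with $\Sigma_\ell v(i_1\cdots i_k)=v(\ell\, i_1\cdots i_k)$, and put $\Xi_\ell=\mathrm i^{\ell}\Sigma_\ell+\mathrm i^{-\ell}\Sigma_\ell^*$. Let $L=\sum_{\ell\ge1}\mathbf X_\ell\otimes a_\ell\in\mathbb C\langle\mathbf X\rangle\otimes\mathcal S$ be an $\mathcal S$-linear form, where $\mathbb C\langle\mathbf X\rangle$ is the noncommutative polynomial algebra in $\mathbf X_1,\mathbf X_2,\dots$ and $a_\ell\in\mathcal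 S$ vanishes for all but finitely many $\ell$. Put $L(\Xi)=\sum_\ell\Xi_\ell\otimes a_\ell\in B(\mathcal H)\otimes\mathcal S$, $\Phi_L(\zeta)=\sum_\ell a_\ell\zeta a_\ell$ for $\zeta\in\mathcal S$, $$\mathcal D_L=\{\Lambda\in\mathcal S : L(\Xi)-1_{B(\mathcal H)}\otimes\Lambda\ \text{is invertible in}\ B(\mathcal H)\otimes\mathcal S\},$$ $$G_L(\Lambda)=\phi_{\mathcal S}\bigl((L(\Xi)-1_{B(\mathcal H)}\otimes\Lambda)^{-1}\bigr)\qquad(\Lambda\in\mathcal D_L).$$ Then $G_L:\mathcal D_L\to\mathcal S$ is a solution of the Schwinger–Dyson equation with covariance map $\Phi_L$: the set $\mathcal D_L$ is nonempty and open in $\mathcal S$, the function $G_L$ is analytic on $\mathcal D_L$, and $$1_{\mathcal S}+\bigl(\Lambda+\Phi_L(G_L(\Lambda))\bigr)G_L(\Lambda)=0\qquad\text{for all }\Lambda\in\mathcal D_L .$$ -/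

import Mathlib

open scoped TensorProduct

namespace SchwingerDyson

noncomputable section

/-- A block algebra: a (unital) C⋆-algebra isomorphic to `Mat_s(ℂ)` for some integer `s > 0`. -/
def IsBlockAlgebra (S : Type*) [CStarAlgebra S] : Prop :=
  ∃ s : ℕ, 0 < s ∧ Nonempty (S ≃⋆ₐ[ℂ] Matrix (Fin s) (Fin s) ℂ)

/-- Boltzmann–Fock space: the Hilbert space with orthonormal basis indexed by all finite
sequences of positive integers, including the empty one. -/
abbrev BF : Type := lp (fun _ : List ℕ+ => ℂ) 2

/-- The basis vector `v(i₁ ⋯ i_k)`. -/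
def v (w : List ℕ+) : BF := lp.single 2 w (1 : ℂ)

theorem orthonormal_v : Orthonormal ℂ v := by
  rw [orthonormal_iff_ite]
  intro i j
  simp only [v]
  rw [lp.inner_single_left, lp.single_apply]
  by_cases h : i = j
  · subst h; simp
  · simp [h]

theorem orthonormal_v_cons (i : ℕ+) : Orthonormal ℂ fun w : List ℕ+ => v (i :: w) :=
  orthonormal_v.comp _ (List.cons_injective)

/-- The bounded operators on Boltzmann–Fock space. -/
abbrev BH : Type := BF →L[ℂ] BF

/-- The vectorial state `φ(A) = (v(∅), A v(∅))` (inner product linear on the right). -/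
def phiBF : BH →ₗ[ℂ] ℂ where
  toFun A := inner ℂ (v []) (A (v []))
  map_add' A B := by simp
  map_smul' c A := by simp

/-- The raising operator `Σ_i`, the isometry with `Σ_i v(i₁ ⋯ i_k) = v(i i₁ ⋯ i_k)`
(see `raise_v`). -/
def raise (i : ℕ+) : BH :=
  (orthonormal_v_cons i).orthogonalFamily.linearIsometry.toContinuousLinearMap

theorem raise_v (i : ℕ+) (w : List ℕ+) : raise i (v w) = v (i :: w) := by
  simp [raise, v, OrthogonalFamily.linearIsometry_apply_single]

/-- The semicircular variables `Ξ_ℓ = i^ℓ Σ_ℓ + i^{-ℓ} Σ_ℓ^*`. -/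
def Xi (l : ℕ+) : BH :=
  Complex.I ^ ((l : ℕ) : ℤ) • raise l
    + Complex.I ^ (-((l : ℕ) : ℤ)) • ContinuousLinearMap.adjoint (raise l)

section

variable (S : Type*) [CStarAlgebra S]

/-- An `S`-linear form: an element of `ℂ⟨X⟩ ⊗ S` together with its Hamel expansion
`∑_ℓ X_ℓ ⊗ a_ℓ`, all but finitely many Hamel coefficients `a_ℓ` being zero. -/
structure LinearForm where
  /-- The underlying element of `ℂ⟨X⟩ ⊗ S`. -/
  val : FreeAlgebra ℂ ℕ+ ⊗[ℂ] S
  /-- The Hamel coefficients. -/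
  coeff : ℕ+ →₀ S
  val_eq : val = coeff.sum fun l a => FreeAlgebra.ι ℂ l ⊗ₜ[ℂ] a

/-- The `S`-linear extension `φ_S : B(H) ⊗ S → S`, `x ⊗ y ↦ φ(x) y`, of the state `φ`. -/
def phiS : BH ⊗[ℂ] S →ₗ[ℂ] S :=
  (TensorProduct.lid ℂ S).toLinearMap ∘ₗ LinearMap.rTensor S phiBF

theorem phiS_tmul (x : BH) (y : S) : phiS S (x ⊗ₜ[ℂ] y) = phiBF x • y := by
  simp [phiS]

end

section

variable {S : Type*} [CStarAlgebra S]

/-- Evaluation `L(ξ)` of `L` at a sequence `ξ` in an algebra, by substituting `ξ_ℓ` for `X_ℓ`. -/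
def LinearForm.eval (L : LinearForm S) {A : Type*} [Ring A] [Algebra ℂ A] (x : ℕ+ → A) :
    A ⊗[ℂ] S :=
  Algebra.TensorProduct.map (FreeAlgebra.lift ℂ x) (AlgHom.id ℂ S) L.val

theorem LinearForm.eval_eq (L : LinearForm S) {A : Type*} [Ring A] [Algebra ℂ A] (x : ℕ+ → A) :
    L.eval x = L.coeff.sum fun l a => x l ⊗ₜ[ℂ] a := by
  simp [LinearForm.eval, L.val_eq, Finsupp.sum, map_sum]

/-- The covariance map `Φ_L(ζ) = ∑ a_ℓ ζ a_ℓ`. -/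
def LinearForm.Phi (L : LinearForm S) : S →L[ℂ] S :=
  L.coeff.sum fun _ a => ContinuousLinearMap.mulLeftRight ℂ S a a

theorem LinearForm.Phi_apply (L : LinearForm S) (z : S) :
    L.Phi z = L.coeff.sum fun _ a => a * z * a := by
  simp [LinearForm.Phi, Finsupp.sum]

/-- The operator `L(Ξ) - 1 ⊗ Λ` in `B(H) ⊗ S`. As `S` is finite-dimensional for block algebras,
the C⋆-algebraic tensor product is the algebraic one. -/
def LinearForm.pencil (L : LinearForm S) (Λ : S) : BH ⊗[ℂ] S :=
  L.eval Xi - (1 : BH) ⊗ₜ[ℂ] Λ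

/-- The domain `D_L` of all `Λ` for which `L(Ξ) - 1 ⊗ Λ` is invertible. -/
def LinearForm.domain (L : LinearForm S) : Set S := {Λ | IsUnit (L.pencil Λ)}

/-- `G_L(Λ) = φ_S((L(Ξ) - 1 ⊗ Λ)⁻¹)`, meaningful for `Λ ∈ D_L`. -/
def LinearForm.G (L : LinearForm S) (Λ : S) : S := phiS S (Ring.inverse (L.pencil Λ))

/-- `G : D → S` is a solution of the Schwinger–Dyson equation with covariance map `Φ`:
`D` is a nonempty open set, `G` is analytic on `D`, and `1 + (Λ + Φ(G(Λ))) G(Λ) = 0` on `D`. -/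
structure IsSDSolution (Φ : S →L[ℂ] S) (D : Set S) (G : S → S) : Prop where
  nonempty : D.Nonempty
  isOpen : IsOpen D
  analytic : AnalyticOnNhd ℂ G D
  equation : ∀ Λ ∈ D, 1 + (Λ + Φ (G Λ)) * G Λ = 0

end

end

end SchwingerDyson

/-! The variables `Ξ_l` admit a dual system: the operators `d_l = i^{-l} R_l^*`, with `R_l` the
isometry appending the letter `l` on the right, satisfy `[d_l, Ξ_j] = δ_{lj} p` for the vacuum
projection `p`, while `φ(Ξ_l · ) = φ(d_l · )` and `φ( · d_l) = 0`. If `T` is the inverse of the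
pencil `L(Ξ) - 1 ⊗ Λ`, so that `φ_S(T) = G`, the commutation relation gives
`(d_l ⊗ 1) T = T (d_l ⊗ 1) - T (p ⊗ a_l) T`, whence `φ_S((Ξ_l ⊗ a_l) T) = - a_l G a_l G`.
Applying `φ_S` to `(L(Ξ) - 1 ⊗ Λ) T = 1` yields the equation. The topological assertions
reduce, through the left regular representation of `B(H) ⊗ S` on `B(H)^{dim S}`, to the
corresponding facts about inverses in a Banach algebra. -/

namespace SchwingerDyson

noncomputable section

section DualSystem

variable {R A S ι : Type*} [CommRing R] [Ring A] [Algebra R A] [Ring S] [Algebra R S]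

/-- The slice map `A ⊗ S → S`, `x ⊗ y ↦ φ(x) y`, of a linear functional `φ` on `A`; the map `φ_S`
of the paper is the slice map of the vacuum state. -/
def slice (S : Type*) [Ring S] [Algebra R S] (φ : A →ₗ[R] R) : A ⊗[R] S →ₗ[R] S :=
  (TensorProduct.lid R S).toLinearMap ∘ₗ LinearMap.rTensor S φ

theorem slice_tmul (φ : A →ₗ[R] R) (x : A) (y : S) : slice S φ (x ⊗ₜ y) = φ x • y := by
  simp [slice]

theorem slice_zero : slice S (0 : A →ₗ[R] R) = 0 := by
  simp [slice]

theorem slice_tmul_mul (φ : A →ₗ[R] R) (x : A) (a : S) (T : A ⊗[R] S) :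
    slice S φ (x ⊗ₜ a * T) = a * slice S (φ ∘ₗ LinearMap.mulLeft R x) T := by
  induction T with
  | zero => simp
  | tmul y b => simp [slice_tmul]
  | add T U hT hU => simp only [mul_add, map_add, hT, hU]

theorem slice_mul_tmul (φ : A →ₗ[R] R) (x : A) (a : S) (T : A ⊗[R] S) :
    slice S φ (T * x ⊗ₜ a) = slice S (φ ∘ₗ LinearMap.mulRight R x) T * a := by
  induction T with
  | zero => simp
  | tmul y b => simp [slice_tmul]
  | add T U hT hU => simp only [add_mul, map_add, hT, hU]

theorem slice_mul_tmul_mul {φ : A →ₗ[R] R} {p : A} (hp : ∀ x y, φ (x * p * y) = φ x * φ y)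
    (T U : A ⊗[R] S) (a : S) : slice S φ (T * p ⊗ₜ a * U) = slice S φ T * a * slice S φ U := by
  induction T with
  | zero => simp
  | tmul x b =>
    have hx : φ ∘ₗ LinearMap.mulLeft R (x * p) = φ x • φ := by
      ext y
      exact hp x y
    rw [Algebra.TensorProduct.tmul_mul_tmul, slice_tmul_mul, hx, slice_tmul]
    simp [slice, LinearMap.rTensor_smul]
  | add T T' hT hT' => simp only [add_mul, map_add, hT, hT']

/-- `d` is a dual system, in the sense of Voiculescu, of the variables `x` in the noncommutative
probability space `(A, φ)`: `[d_l, x_j] = δ_{lj} p`, where `p` plays the role of the projection onto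
the vacuum vector. The field `map_var_mul` says that `x_l` is its own conjugate variable, which
is characteristic of semicircular variables. -/
structure IsDualSystem [DecidableEq ι] (φ : A →ₗ[R] R) (p : A) (x d : ι → A) : Prop where
  map_one : φ 1 = 1
  map_mul_proj_mul : ∀ a b, φ (a * p * b) = φ a * φ b
  map_mul_dual : ∀ l a, φ (a * d l) = 0
  map_var_mul : ∀ l a, φ (x l * a) = φ (d l * a)
  dual_mul_var : ∀ l j, d l * x j = x j * d l + if l = j then p else 0

/-- The affine pencil `∑ x_l ⊗ a_l - 1 ⊗ Λ` in the variables `x`. -/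
def affinePencil (x : ι → A) (a : ι →₀ S) (Λ : S) : A ⊗[R] S :=
  (a.sum fun l b => x l ⊗ₜ b) - 1 ⊗ₜ Λ

namespace IsDualSystem

variable [DecidableEq ι] {φ : A →ₗ[R] R} {p : A} {x d : ι → A} (h : IsDualSystem φ p x d)
  (a : ι →₀ S) (Λ : S)

include h

theorem dual_tmul_one_mul_pencil (l : ι) :
    d l ⊗ₜ 1 * affinePencil (R := R) x a Λ = affinePencil x a Λ * d l ⊗ₜ 1 + p ⊗ₜ a l := by
  have hsum : d l ⊗ₜ[R] 1 * (a.sum fun j b => x j ⊗ₜ[R] b) =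
      (a.sum fun j b => x j ⊗ₜ b) * d l ⊗ₜ 1 + p ⊗ₜ a l := by
    have hδ : (a.sum fun j b => (if l = j then p else 0) ⊗ₜ[R] b) = p ⊗ₜ a l := by
      rw [Finsupp.sum_eq_single l (fun j _ hj => by simp [hj.symm]) (by simp), if_pos rfl]
    rw [← hδ]
    simp only [Finsupp.sum, Finset.mul_sum, Finset.sum_mul, ← Finset.sum_add_distrib,
      Algebra.TensorProduct.tmul_mul_tmul, one_mul, mul_one, h.dual_mul_var,
      TensorProduct.add_tmul]
  simp only [affinePencil, mul_sub, sub_mul, hsum, Algebra.TensorProduct.tmul_mul_tmul, one_mul,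
    mul_one]
  abel

variable {a Λ} {T : A ⊗[R] S}

theorem slice_dual_tmul_one_mul (hl : T * affinePencil x a Λ = 1)
    (hr : affinePencil x a Λ * T = 1) (l : ι) :
    slice S φ (d l ⊗ₜ 1 * T) = -(slice S φ T * a l * slice S φ T) := by
  have hcomm : d l ⊗ₜ 1 * T = T * d l ⊗ₜ 1 - T * p ⊗ₜ a l * T := by
    calc d l ⊗ₜ 1 * T = T * (affinePencil x a Λ * d l ⊗ₜ 1) * T := by
          rw [← mul_assoc T, hl, one_mul]
      _ = T * (d l ⊗ₜ 1 * affinePencil x a Λ - p ⊗ₜ a l) * T := by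
          rw [h.dual_tmul_one_mul_pencil, add_sub_cancel_right]
      _ = T * d l ⊗ₜ 1 * (affinePencil x a Λ * T) - T * p ⊗ₜ a l * T := by
          simp only [mul_sub, sub_mul, mul_assoc]
      _ = T * d l ⊗ₜ 1 - T * p ⊗ₜ a l * T := by rw [hr, mul_one]
  have hd : φ ∘ₗ LinearMap.mulRight R (d l) = 0 := LinearMap.ext (h.map_mul_dual l)
  rw [hcomm, map_sub, slice_mul_tmul, hd, slice_zero, LinearMap.zero_apply, zero_mul, zero_sub,
    slice_mul_tmul_mul h.map_mul_proj_mul]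

theorem slice_var_tmul_mul (hl : T * affinePencil x a Λ = 1)
    (hr : affinePencil x a Λ * T = 1) (l : ι) (b : S) :
    slice S φ (x l ⊗ₜ b * T) = -(b * (slice S φ T * a l * slice S φ T)) := by
  have hx : φ ∘ₗ LinearMap.mulLeft R (x l) = φ ∘ₗ LinearMap.mulLeft R (d l) :=
    LinearMap.ext (h.map_var_mul l)
  rw [← mul_neg, ← h.slice_dual_tmul_one_mul hl hr, slice_tmul_mul, slice_tmul_mul, hx, one_mul]

theorem schwingerDyson (hl : T * affinePencil x a Λ = 1) (hr : affinePencil x a Λ * T = 1) :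
    1 + (Λ + a.sum fun _ b => b * slice S φ T * b) * slice S φ T = 0 := by
  have hvar : slice S φ ((a.sum fun l b => x l ⊗ₜ b) * T) =
      -((a.sum fun _ b => b * slice S φ T * b) * slice S φ T) := by
    simp only [Finsupp.sum, Finset.sum_mul, map_sum, ← Finset.sum_neg_distrib,
      h.slice_var_tmul_mul hl hr, mul_assoc]
  have hconst : slice S φ (1 ⊗ₜ Λ * T) = Λ * slice S φ T := by
    rw [slice_tmul_mul, LinearMap.mulLeft_one, LinearMap.comp_id]
  have hone : slice S φ (1 : A ⊗[R] S) = 1 := by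
    rw [Algebra.TensorProduct.one_def, slice_tmul, h.map_one, one_smul]
  rw [← hone, ← hr, affinePencil, sub_mul, map_sub, hvar, hconst, add_mul]
  abel

end IsDualSystem

end DualSystem

section Fock

open ContinuousLinearMap (adjoint)

theorem inner_v_left (w : List ℕ+) (x : BF) : inner ℂ (v w) x = x w := by
  simp [v, lp.inner_single_left]

theorem v_apply (w u : List ℕ+) : v w u = if u = w then 1 else 0 := by
  rw [← inner_v_left, orthonormal_iff_ite.1 orthonormal_v]

theorem adjoint_raise_apply (i : ℕ+) (x : BF) (w : List ℕ+) :
    adjoint (raise i) x w = x (i :: w) := by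
  rw [← inner_v_left, ContinuousLinearMap.adjoint_inner_right, raise_v, inner_v_left]

theorem raise_apply_nil (i : ℕ+) (x : BF) : raise i x [] = 0 := by
  have h : adjoint (raise i) (v []) = 0 := by
    ext w
    simp [adjoint_raise_apply, v_apply]
  rw [← inner_v_left, ← ContinuousLinearMap.adjoint_inner_left, h, inner_zero_left]

theorem raise_apply_cons (i j : ℕ+) (x : BF) (w : List ℕ+) :
    raise i x (j :: w) = if i = j then x w else 0 := by
  have h : adjoint (raise i) (v (j :: w)) = if i = j then v w else 0 := by
    ext u
    split_ifs with hij <;> simp [adjoint_raise_apply, v_apply, hij]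
  rw [← inner_v_left, ← ContinuousLinearMap.adjoint_inner_left, h]
  split_ifs
  · exact inner_v_left w x
  · exact inner_zero_left x

theorem orthonormal_v_concat (j : ℕ+) : Orthonormal ℂ fun w : List ℕ+ => v (w ++ [j]) :=
  orthonormal_v.comp _ (List.append_left_injective [j])

/-- The right raising operator, the isometry `v(i₁ ⋯ i_k) ↦ v(i₁ ⋯ i_k j)`. -/
def raiseRight (j : ℕ+) : BH :=
  (orthonormal_v_concat j).orthogonalFamily.linearIsometry.toContinuousLinearMap

theorem raiseRight_v (j : ℕ+) (w : List ℕ+) : raiseRight j (v w) = v (w ++ [j]) := by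
  simp [raiseRight, v, OrthogonalFamily.linearIsometry_apply_single]

theorem adjoint_raiseRight_apply (j : ℕ+) (x : BF) (w : List ℕ+) :
    adjoint (raiseRight j) x w = x (w ++ [j]) := by
  rw [← inner_v_left, ContinuousLinearMap.adjoint_inner_right, raiseRight_v, inner_v_left]

/-- The orthogonal projection onto the line spanned by the vacuum vector `v(∅)`. -/
def vacuumProj : BH := (innerSL ℂ (v [])).smulRight (v [])

theorem vacuumProj_apply (x : BF) : vacuumProj x = x [] • v [] := by
  simp [vacuumProj, inner_v_left]

theorem vacuumProj_apply_nil (x : BF) : vacuumProj x [] = x [] := by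
  simp [vacuumProj_apply, v_apply]

theorem vacuumProj_apply_cons (x : BF) (i : ℕ+) (w : List ℕ+) : vacuumProj x (i :: w) = 0 := by
  simp [vacuumProj_apply, v_apply]

/-- The vacuum state as a continuous linear functional. -/
def vacuumState : BH →L[ℂ] ℂ :=
  innerSL ℂ (v []) ∘L ContinuousLinearMap.apply ℂ BF (v [])

theorem phiBF_apply (A : BH) : phiBF A = A (v []) [] :=
  inner_v_left [] _

theorem Xi_apply (l : ℕ+) (x : BF) (w : List ℕ+) :
    Xi l x w = Complex.I ^ (l : ℕ) * raise l x w + (Complex.I ^ (l : ℕ))⁻¹ * x (l :: w) := by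
  rw [← adjoint_raise_apply, ← zpow_natCast, ← zpow_neg]
  rfl

/-- The dual system of the semicircular variables `Ξ_l`. The phase `i^{-l}` cancels the one with
which `Σ_l` enters `Ξ_l`. -/
def dualXi (l : ℕ+) : BH := (Complex.I ^ (l : ℕ))⁻¹ • adjoint (raiseRight l)

theorem dualXi_apply (l : ℕ+) (x : BF) (w : List ℕ+) :
    dualXi l x w = (Complex.I ^ (l : ℕ))⁻¹ * x (w ++ [l]) := by
  rw [← adjoint_raiseRight_apply]
  rfl

theorem dualXi_mul_Xi (l j : ℕ+) :
    dualXi l * Xi j = Xi j * dualXi l + if l = j then vacuumProj else 0 := by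
  ext x w
  have hadd (y z : BF) : (y + z) w = y w + z w := rfl
  rw [add_apply, hadd]
  simp only [mul_apply_eq_comp, dualXi_apply, Xi_apply]
  cases w with
  | nil =>
    obtain rfl | hlj := eq_or_ne l j
    · simp only [List.nil_append, List.cons_append, raise_apply_nil, raise_apply_cons,
        vacuumProj_apply_nil, if_true]
      field
    · simp only [List.nil_append, List.cons_append, raise_apply_nil, raise_apply_cons, hlj,
        hlj.symm, if_false, zero_apply, ZeroMemClass.coe_zero, PreLp.zero_apply]
      ring
  | cons k u =>
    have hproj : (if l = j then vacuumProj else 0) x (k :: u) = 0 := by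
      split_ifs
      · exact vacuumProj_apply_cons x k u
      · rfl
    simp only [List.cons_append, raise_apply_cons, dualXi_apply, hproj]
    split_ifs <;> ring

theorem isDualSystem_Xi : IsDualSystem phiBF vacuumProj Xi dualXi where
  map_one := by simp [phiBF_apply, v_apply]
  map_mul_proj_mul A B := by simp [phiBF_apply, vacuumProj_apply, mul_comm]
  map_mul_dual l A := by
    have h : dualXi l (v []) = 0 := by
      ext w
      simp [dualXi_apply, v_apply]
    simp [phiBF_apply, h]
  map_var_mul l A := by simp [phiBF_apply, Xi_apply, dualXi_apply, raise_apply_nil]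
  dual_mul_var := dualXi_mul_Xi

end Fock

section LeftRegular

variable {𝕜 B V : Type*} [NontriviallyNormedField 𝕜] [Ring B] [Algebra 𝕜 B]
  [NormedAddCommGroup V] [NormedSpace 𝕜 V] (κ : B ≃ₗ[𝕜] V)
  (hκ : ∀ x, Continuous fun f => κ (x * κ.symm f))

/-- The left regular representation of an algebra `B` that is identified by `κ` with a normed
space on which left multiplications are continuous. Operators on that space form a normed
algebra, whereas `B` itself carries no norm. -/
def leftRegular : B →ₐ[𝕜] (V →L[𝕜] V) where
  toFun x := ⟨κ.conjAlgEquiv 𝕜 (Algebra.lmul 𝕜 B x), hκ x⟩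
  map_one' := by ext; simp
  map_mul' x y := by ext; simp [mul_assoc]
  map_zero' := by ext; simp
  map_add' x y := by ext; simp
  commutes' c := by ext; simp [Algebra.algebraMap_eq_smul_one]

theorem leftRegular_apply (x : B) (f : V) : leftRegular κ hκ x f = κ (x * κ.symm f) := rfl

theorem isUnit_leftRegular_iff {x : B} : IsUnit (leftRegular κ hκ x) ↔ IsUnit x := by
  refine ⟨fun h => ?_, fun h => h.map _⟩
  have hend : IsUnit (κ.conjAlgEquiv 𝕜 (Algebra.lmul 𝕜 B x)) :=
    h.map ContinuousLinearMap.toLinearMapRingHom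
  rwa [MulEquiv.isUnit_map, Algebra.lmul_isUnit_iff] at hend

theorem apply_inverse_eq_inverse_leftRegular (x : B) :
    κ (Ring.inverse x) = Ring.inverse (leftRegular κ hκ x) (κ 1) := by
  by_cases h : IsUnit x
  · obtain ⟨u, rfl⟩ := h
    have hinv : Ring.inverse (leftRegular κ hκ u) = leftRegular κ hκ ↑u⁻¹ :=
      Ring.inverse_unit (Units.map (leftRegular κ hκ : B →* V →L[𝕜] V) u)
    simp [hinv, leftRegular_apply]
  · rw [Ring.inverse_non_unit _ h, Ring.inverse_non_unit _ (by rwa [isUnit_leftRegular_iff]),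
      map_zero, zero_apply]

include hκ in
theorem exists_isUnit_sub_algebraMap [CompleteSpace V] (x : B) :
    ∃ c : 𝕜, IsUnit (x - algebraMap 𝕜 B c) := by
  obtain ⟨c, hc⟩ := NormedField.exists_lt_norm 𝕜
    (‖leftRegular κ hκ x‖ * ‖(1 : V →L[𝕜] V)‖)
  have hres : IsUnit (algebraMap 𝕜 (V →L[𝕜] V) c - leftRegular κ hκ x) :=
    spectrum.mem_resolventSet_of_norm_lt_mul hc
  refine ⟨c, (isUnit_leftRegular_iff κ hκ).1 ?_⟩
  rwa [map_sub, AlgHom.commutes, ← IsUnit.neg_iff, neg_sub]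

variable [CompleteSpace 𝕜] {E : Type*} [NormedAddCommGroup E] [NormedSpace 𝕜 E]
  [FiniteDimensional 𝕜 E] (x : B) (T : E →ₗ[𝕜] B)

theorem analyticAt_leftRegular_sub (y : E) :
    AnalyticAt 𝕜 (fun z => leftRegular κ hκ (x - T z)) y := by
  let T' : E →L[𝕜] V →L[𝕜] V := ((leftRegular κ hκ).toLinearMap ∘ₗ T).toContinuousLinearMap
  simp only [map_sub]
  exact analyticAt_const.sub (T'.analyticAt y)

variable [CompleteSpace V]

include hκ

theorem isOpen_setOf_isUnit_sub : IsOpen {y | IsUnit (x - T y)} := by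
  have hcont : Continuous fun y => leftRegular κ hκ (x - T y) :=
    continuous_iff_continuousAt.2 fun y => (analyticAt_leftRegular_sub κ hκ x T y).continuousAt
  simpa only [isUnit_leftRegular_iff, Set.preimage_ofPred_eq] using Units.isOpen.preimage hcont

theorem analyticOnNhd_inverse_sub :
    AnalyticOnNhd 𝕜 (fun y => κ (Ring.inverse (x - T y))) {y | IsUnit (x - T y)} := by
  intro y hy
  have hinv : AnalyticAt 𝕜 Ring.inverse (leftRegular κ hκ (x - T y)) :=
    analyticAt_inverse (𝕜 := 𝕜) ((isUnit_leftRegular_iff κ hκ).2 hy).unit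
  simp only [apply_inverse_eq_inverse_leftRegular κ hκ]
  exact ((ContinuousLinearMap.apply 𝕜 V (κ 1)).analyticAt _).comp
    (AnalyticAt.comp (f := fun z => leftRegular κ hκ (x - T z)) hinv
      (analyticAt_leftRegular_sub κ hκ x T y))

end LeftRegular

section TensorCoordinates

variable {R ι : Type*} [CommRing R] [Fintype ι] [DecidableEq ι]

section Module

variable {M N : Type*} [AddCommGroup M] [Module R M] [AddCommGroup N] [Module R N]

variable (M) in
/-- The coordinates of `M ⊗ N` with respect to a basis of `N`. They identify `A ⊗ S` with the
topological module `A^ι`. -/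
def tensorCoord (b : Module.Basis ι R N) : M ⊗[R] N ≃ₗ[R] (ι → M) :=
  TensorProduct.equivFinsuppOfBasisRight b ≪≫ₗ Finsupp.linearEquivFunOnFinite R M ι

variable (b : Module.Basis ι R N)

theorem tensorCoord_tmul (x : M) (y : N) (i : ι) :
    tensorCoord M b (x ⊗ₜ y) i = b.repr y i • x := by
  simp [tensorCoord]

theorem tensorCoord_symm_apply (f : ι → M) :
    (tensorCoord M b).symm f = ∑ i, f i ⊗ₜ b i := by
  rw [LinearEquiv.symm_apply_eq]
  ext i
  simp [tensorCoord_tmul, Finsupp.single_apply]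

end Module

variable {A S : Type*} [Ring A] [Algebra R A] [TopologicalSpace A] [Ring S] [Algebra R S]
  (b : Module.Basis ι R S)

theorem continuous_tensorCoord_mul [IsTopologicalRing A] [ContinuousConstSMul R A]
    (X : A ⊗[R] S) : Continuous fun f => tensorCoord A b (X * (tensorCoord A b).symm f) := by
  induction X with
  | zero => simpa using continuous_const
  | tmul x y =>
    refine continuous_pi fun i => ?_
    simp only [tensorCoord_symm_apply, Finset.mul_sum, Algebra.TensorProduct.tmul_mul_tmul,
      map_sum, Finset.sum_apply, tensorCoord_tmul]
    fun_prop
  | add X Y hX hY =>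
    simp only [add_mul, map_add]
    exact hX.add hY

variable [TopologicalSpace R] [TopologicalSpace S] [ContinuousAdd S] [ContinuousSMul R S]

/-- The slice map of a continuous functional, in the coordinates `tensorCoord`. -/
def sliceCoord (φ : A →L[R] R) : (ι → A) →L[R] S :=
  ∑ i, (φ ∘L ContinuousLinearMap.proj i).smulRight (b i)

theorem sliceCoord_tensorCoord (φ : A →L[R] R) (X : A ⊗[R] S) :
    sliceCoord b φ (tensorCoord A b X) = slice S (φ : A →ₗ[R] R) X := by
  obtain ⟨f, rfl⟩ := (tensorCoord A b).symm.surjective X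
  rw [LinearEquiv.apply_symm_apply, tensorCoord_symm_apply]
  simp [sliceCoord, slice_tmul]

end TensorCoordinates

namespace LinearForm

variable {S : Type*} [CStarAlgebra S] (L : LinearForm S)

theorem pencil_eq (Λ : S) : L.pencil Λ = affinePencil Xi L.coeff Λ := by
  rw [pencil, eval_eq, affinePencil]

theorem one_add_mul_G {Λ : S} (hΛ : Λ ∈ L.domain) : 1 + (Λ + L.Phi (L.G Λ)) * L.G Λ = 0 := by
  rw [L.Phi_apply]
  have hunit : IsUnit (L.pencil Λ) := hΛ
  refine isDualSystem_Xi.schwingerDyson (T := Ring.inverse (L.pencil Λ)) ?_ ?_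
  · rw [← pencil_eq, Ring.inverse_mul_cancel _ hunit]
  · rw [← pencil_eq, Ring.mul_inverse_cancel _ hunit]

variable [FiniteDimensional ℂ S]

theorem domain_nonempty : L.domain.Nonempty := by
  let b := Module.finBasis ℂ S
  obtain ⟨c, hc⟩ := exists_isUnit_sub_algebraMap (tensorCoord BH b)
    (continuous_tensorCoord_mul b) (L.eval Xi)
  refine ⟨algebraMap ℂ S c, ?_⟩
  rwa [Algebra.TensorProduct.algebraMap_apply'] at hc

theorem isOpen_domain : IsOpen L.domain :=
  let b := Module.finBasis ℂ S
  isOpen_setOf_isUnit_sub (tensorCoord BH b) (continuous_tensorCoord_mul b) (L.eval Xi)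
    (TensorProduct.mk ℂ BH S 1)

theorem analyticOnNhd_G : AnalyticOnNhd ℂ L.G L.domain := by
  let b := Module.finBasis ℂ S
  have hG : L.G = fun Λ =>
      sliceCoord b vacuumState (tensorCoord BH b (Ring.inverse (L.pencil Λ))) :=
    funext fun Λ => (sliceCoord_tensorCoord b vacuumState _).symm
  rw [hG]
  exact (sliceCoord b vacuumState).comp_analyticOnNhd
    (analyticOnNhd_inverse_sub (tensorCoord BH b) (continuous_tensorCoord_mul b) (L.eval Xi)
      (TensorProduct.mk ℂ BH S 1))

end LinearForm

theorem IsBlockAlgebra.finiteDimensional {S : Type*} [CStarAlgebra S] (hS : IsBlockAlgebra S) :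
    FiniteDimensional ℂ S := by
  obtain ⟨s, -, ⟨e⟩⟩ := hS
  exact e.symm.toAlgEquiv.toLinearEquiv.finiteDimensional

end

end SchwingerDyson

theorem proposition5p2_general {S : Type*} [CStarAlgebra S] [FiniteDimensional ℂ S]
    (L : SchwingerDyson.LinearForm S) :
    SchwingerDyson.IsSDSolution L.Phi L.domain L.G where
  nonempty := L.domain_nonempty
  isOpen := L.isOpen_domain
  analytic := L.analyticOnNhd_G
  equation _ hΛ := L.one_add_mul_G hΛ

theorem proposition5p2 {S : Type*} [CStarAlgebra S] (hS : SchwingerDyson.IsBlockAlgebra S)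
    (L : SchwingerDyson.LinearForm S) :
    SchwingerDyson.IsSDSolution L.Phi L.domain L.G := by
  have := hS.finiteDimensional
  exact proposition5p2_general L
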